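/- Let $\{p_i\}$ be a probability distribution on a finite set of inputs, let $\rho_i$ be density matrices on a finite-dimensional Hilbert space, and let $\{\Lambda_j\}$ be a POVM with finitely many outcomes ($\Lambda_j\ge 0$, $\sum_j\Lambda_j=\mathbb 1$). Input $i$ occurs with probability $p_i$ and is encoded as $\rho_i$; the state is measured with $\{\Lambda_j\}$, so that outcome $j$ has conditional probability $p_{j|i}=\mathrm{Tr}\,\rho_i\Lambda_j$. Put $P(i,j)=p_i\,p_{j|i}$, $q_j=\sum_i P(i,j)$ and, if $q_j>0$, $q_{i|j}=P(i,j)/q_j$. Having observed $j$, the gambler bets on the input: she retains a fraction $b_{0|j}\ge 0$ of her wealth and puts a fraction $b_{i|j}\ge 0$ on each input $i$, where $b_{0|j}+\sum_i b_{i|j}=1$. The odds are $o_i$-for-1 with $o_i=1/p_i$ whenever $p_i>0$ (the odds on inputs of probability zero are arbitrary real numbers). The doubling rate of the strategy $b$ is the expected logarithm of the factor by which her wealth grows, $$W(b)=\sum_{i,j}P(i,j)\,\log_2\bigl(b_{0|j}+b_{i|j}\,o_i\bigr)\in[-\infty,\infty),$$ where $\log_2 0=-\infty$ and terms with $P(i,j)=0$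 are omitted. Then the maximum of $W(b)$ over all strategies $b$ exists and equals the mutual information between input and measurement outcome, $$\max_b W(b)=I=\sum_{i,j}P(i,j)\log_2\frac{P(i,j)}{p_i\,q_j}=\sum_j q_j\sum_i q_{i|j}\log_2\frac{q_{i|j}}{p_i},$$ (terms of probability zero being zero), and it is attained by proportional betting, that is, by $b_{0|j}=0$, $b_{i|j}=q_{i|j}$ for all $j$ with $q_j>0$. Moreover it is at most the Holevo information: $$I\le \chi(\{p_i,\rho_i\})=S\Bigl(\sum_i p_i\rho_i\Bigr)-\sum_i p_i\,S(\rho_i),\qquad S(\rho)=-\mathrm{Tr}\,\rho\log_2\rho .$$ -/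

import Mathlib

noncomputable section

namespace QuantumKelly

open scoped BigOperators ComplexOrder

/-- Probability vectors on a finite set. -/
structure IsProbVec {ι : Type*} [Fintype ι] (p : ι → ℝ) : Prop where
  nonneg : ∀ i, 0 ≤ p i
  sum_eq_one : ∑ i, p i = 1

/-- Density matrices: positive semidefinite with unit trace. -/
structure IsDensity {d : Type*} [Fintype d] (ρ : Matrix d d ℂ) : Prop where
  posSemidef : ρ.PosSemidef
  trace_eq_one : ρ.trace = 1

/-- POVMs with finitely many outcomes `j : κ`. -/
structure IsPOVM {d κ : Type*} [Fintype d] [DecidableEq d] [Fintype κ]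
    (Λ : κ → Matrix d d ℂ) : Prop where
  posSemidef : ∀ j, (Λ j).PosSemidef
  sum_eq_one : ∑ j, Λ j = 1

/-- Born rule `p_{j|i} = Tr (ρ_i Λ_j)`. -/
def condProb {d ι κ : Type*} [Fintype d]
    (ρ : ι → Matrix d d ℂ) (Λ : κ → Matrix d d ℂ) (i : ι) (j : κ) : ℝ :=
  (Matrix.trace (ρ i * Λ j)).re

/-- Joint law of input `i` and measurement outcome `j`. -/
def jointProb {d ι κ : Type*} [Fintype d]
    (p : ι → ℝ) (ρ : ι → Matrix d d ℂ) (Λ : κ → Matrix d d ℂ) (i : ι) (j : κ) : ℝ :=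
  p i * condProb ρ Λ i j

/-- Law of the first variable of a joint law `P`. -/
def inputProb {ι κ : Type*} [Fintype κ] (P : ι → κ → ℝ) (i : ι) : ℝ := ∑ j, P i j

/-- Law of the second variable of a joint law `P`. -/
def outputProb {ι κ : Type*} [Fintype ι] (P : ι → κ → ℝ) (j : κ) : ℝ := ∑ i, P i j

/-- `q_{i|j}`, the conditional probability of input `i` given output `j`
(meaningful when the output `j` has positive probability). -/
def posterior {ι κ : Type*} [Fintype ι] (P : ι → κ → ℝ) (i : ι) (j : κ) : ℝ :=
  P i j / outputProb P j

/-- Mutual information in bits of a joint law `P`, i.e. the relative entropy of `P` with respect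
to the product of its marginals. A term with `P i j = 0` is zero. -/
def mutualInfo {ι κ : Type*} [Fintype ι] [Fintype κ] (P : ι → κ → ℝ) : ℝ :=
  ∑ i, ∑ j, P i j * Real.logb 2 (P i j / (inputProb P i * outputProb P j))

/-- What the gambler does with her wealth after seeing the output `j`: she keeps the fraction
`retained j` and puts the fraction `bet j i` on input `i`. -/
structure Strategy (ι κ : Type*) [Fintype ι] where
  retained : κ → ℝ
  bet : κ → ι → ℝ
  retained_nonneg : ∀ j, 0 ≤ retained j
  bet_nonneg : ∀ j i, 0 ≤ bet j i
  sum_eq_one : ∀ j, retained j + ∑ i, bet j i = 1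

/-- Base-two logarithm with `log 0 = -∞`. -/
def elog2 (x : ℝ) : EReal := if x ≤ 0 then ⊥ else (Real.logb 2 x : EReal)

/-- The factor by which wealth is multiplied when the output is `j` and the input was `i`, at odds
`o i`-for-1. -/
def growthFactor {ι κ : Type*} [Fintype ι] (o : ι → ℝ) (b : Strategy ι κ) (i : ι) (j : κ) : ℝ :=
  b.retained j + b.bet j i * o i

/-- Doubling rate: the expected base-two logarithm of the growth factor under the joint law `P` of
input and output. It is `-∞` when ruin has positive probability; since `0 * ⊥ = 0` in `EReal`,
pairs of probability zero contribute nothing. -/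
def doublingRate {ι κ : Type*} [Fintype ι] [Fintype κ]
    (P : ι → κ → ℝ) (o : ι → ℝ) (b : Strategy ι κ) : EReal :=
  ∑ i, ∑ j, (P i j : EReal) * elog2 (growthFactor o b i j)

/-- Proportional betting: nothing is retained, and the fraction `q_{i|j}` is put on input `i`
whenever the output `j` occurs with positive probability. -/
def IsProportional {ι κ : Type*} [Fintype ι] (P : ι → κ → ℝ) (b : Strategy ι κ) : Prop :=
  ∀ j, 0 < outputProb P j → b.retained j = 0 ∧ ∀ i, b.bet j i = posterior P i j

/-- Von Neumann entropy in bits, `-Tr (ρ log₂ ρ)`; the logarithm is the functional calculus of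
`Real.logb 2`, whose value at the eigenvalue zero is multiplied by zero. -/
def vonNeumannEntropy {d : Type*} [Fintype d] [DecidableEq d] (ρ : Matrix d d ℂ) : ℝ :=
  -(Matrix.trace (ρ * cfc (Real.logb 2) ρ)).re

/-- Holevo information `S(∑ p_i ρ_i) - ∑ p_i S(ρ_i)`. -/
def holevoInfo {d ι : Type*} [Fintype d] [DecidableEq d] [Fintype ι]
    (p : ι → ℝ) (ρ : ι → Matrix d d ℂ) : ℝ :=
  vonNeumannEntropy (∑ i, (p i : ℂ) • ρ i) - ∑ i, p i * vonNeumannEntropy (ρ i)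

end QuantumKelly

end

open QuantumKelly

/-! Betting: at odds `1 / p i`, proportional betting makes the growth factor `P i j / (p i * q j)`,
whose expected logarithm is the mutual information. For any other strategy without ruin, `log y ≤ y
- 1` bounds the excess over this value by a sum that vanishes, because the stakes for each output
add up to one.

Holevo: `χ` is the `p`-average of the relative entropies of `ρ i` to the mean state, and the mutual
information is the same average after measurement. The bound is therefore monotonicity of relative
entropy under a POVM, `IsPOVM.relEntropy_le`. With eigenvalues `l a`, `m b` of `ρ`, `σ` and squared
overlaps `w a b` of their eigenvectors, the quantum relative entropy is the classical one of `l a *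
w a b` to `m b * w a b`. By `sum_mul_log_sub_log_le` it then suffices to compare the sums of `p² /
(q + t p)` for each `t > 0`. Each `p² / (q + t p)` with positive denominator is the maximum over `x`
of `2 x p - x² (q + t p)`. The Kadison inequality carries the optimal `x j` of the measured side to
the matrix `X = ∑ x j Λ j`, whose entries are admissible trial values on the quantum side. -/

noncomputable section

namespace QuantumKelly

open scoped ComplexOrder

/-! ### Relative entropy from quadratic divergences -/

open Filter Topology in
/-- Comparison of relative entropies from comparison of a one-parameter family of
quadratic divergences. -/
theorem sum_mul_log_sub_log_le {α β : Type*} [Fintype α] [Fintype β]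
    {p q : α → ℝ} {P Q : β → ℝ} (hp : ∀ a, 0 ≤ p a) (hP : ∀ b, 0 ≤ P b)
    (hpq : ∀ a, 0 < p a → 0 < q a) (hPQ : ∀ b, 0 < P b → 0 < Q b)
    (hsum : ∑ a, p a = ∑ b, P b)
    (h : ∀ t : ℝ, 0 < t → ∑ a, p a ^ 2 / (q a + t * p a) ≤ ∑ b, P b ^ 2 / (Q b + t * P b)) :
    ∑ a, p a * (Real.log (p a) - Real.log (q a)) ≤
      ∑ b, P b * (Real.log (P b) - Real.log (Q b)) := by
  have deriv_aux : ∀ {r s : ℝ}, 0 ≤ r → (0 < r → 0 < s) → ∀ t : ℝ, 0 ≤ t →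
      HasDerivAt (fun t ↦ r * Real.log (s + t * r)) (r ^ 2 / (s + t * r)) t := by
    intro r s hr hrs t ht
    rcases hr.eq_or_lt with rfl | hr
    · simpa using hasDerivAt_const t (0 : ℝ)
    · have hpos : 0 < s + t * r := by have := hrs hr; positivity
      have h1 : HasDerivAt (fun t ↦ s + t * r) r t := by
        simpa using ((hasDerivAt_id t).mul_const r).const_add s
      exact ((h1.log hpos.ne').const_mul r).congr_deriv (by ring)
  have lim_aux : ∀ {r s : ℝ}, 0 ≤ r → (0 < r → 0 < s) →
      Tendsto (fun t ↦ r * Real.log (s + t * r) - r * Real.log t) atTop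
        (𝓝 (r * Real.log r)) := by
    intro r s hr hrs
    rcases hr.eq_or_lt with rfl | hr
    · simp
    · have h1 : Tendsto (fun t : ℝ ↦ s / t + r) atTop (𝓝 r) := by
        simpa using (tendsto_const_nhds.div_atTop tendsto_id).add_const r
      have h2 := ((Real.continuousAt_log hr.ne').tendsto.comp h1).const_mul r
      refine h2.congr' ?_
      filter_upwards [eventually_gt_atTop 0] with t ht
      have hs := hrs hr
      have : s / t + r = (s + t * r) / t := by field_simp
      simp only [Function.comp]
      rw [this, Real.log_div (by positivity) ht.ne']
      ring
  -- `F` has the difference of the quadratic divergences as derivative, and the claim reads `F 0 ≤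
  -- lim F` at infinity.
  set F : ℝ → ℝ := fun t ↦ ∑ b, P b * Real.log (Q b + t * P b) -
    ∑ a, p a * Real.log (q a + t * p a) with hF
  have hderiv : ∀ t, 0 ≤ t → HasDerivAt F
      (∑ b, P b ^ 2 / (Q b + t * P b) - ∑ a, p a ^ 2 / (q a + t * p a)) t := fun t ht ↦
    (HasDerivAt.fun_sum fun b _ ↦ deriv_aux (hP b) (hPQ b) t ht).fun_sub
      (HasDerivAt.fun_sum fun a _ ↦ deriv_aux (hp a) (hpq a) t ht)
  have hmono : MonotoneOn F (Set.Ici 0) := by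
    refine monotoneOn_of_deriv_nonneg (convex_Ici 0)
      (fun t ht ↦ (hderiv t ht).continuousAt.continuousWithinAt) ?_ ?_
    · intro t ht
      rw [interior_Ici] at ht
      exact (hderiv t (le_of_lt ht)).differentiableAt.differentiableWithinAt
    · intro t ht
      rw [interior_Ici] at ht
      rw [(hderiv t (le_of_lt ht)).deriv]
      exact sub_nonneg.2 (h t ht)
  have hlim : Tendsto F atTop
      (𝓝 (∑ b, P b * Real.log (P b) - ∑ a, p a * Real.log (p a))) := by
    have := (tendsto_finsetSum Finset.univ fun b _ ↦ lim_aux (hP b) (hPQ b)).sub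
      (tendsto_finsetSum Finset.univ fun a _ ↦ lim_aux (hp a) (hpq a))
    -- The divergent terms in `log t` cancel because both families have the same total mass.
    refine this.congr fun t ↦ ?_
    simp only [Finset.sum_sub_distrib, ← Finset.sum_mul, hsum, hF]
    ring
  have hle : F 0 ≤ ∑ b, P b * Real.log (P b) - ∑ a, p a * Real.log (p a) := by
    refine ge_of_tendsto hlim ?_
    filter_upwards [eventually_ge_atTop 0] with t ht
    exact hmono (Set.mem_Ici.2 le_rfl) ht ht
  simp only [hF, zero_mul, add_zero] at hle
  simp only [mul_sub, Finset.sum_sub_distrib]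
  linarith

/-! ### Traces in eigenbases and operator inequalities -/

open Matrix in
/-- Hermitian matrices are unitarily diagonal, compatibly with the functional calculus. -/
theorem exists_diagonalization {d : Type*} [Fintype d] [DecidableEq d]
    {A : Matrix d d ℂ} (hA : A.PosSemidef) :
    ∃ (U : Matrix d d ℂ) (l : d → ℝ), Uᴴ * U = 1 ∧ U * Uᴴ = 1 ∧ (∀ a, 0 ≤ l a) ∧
      A = U * diagonal (fun a ↦ (l a : ℂ)) * Uᴴ ∧
      ∀ f : ℝ → ℝ, cfc f A = U * diagonal (fun a ↦ (f (l a) : ℂ)) * Uᴴ := by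
  refine ⟨hA.1.eigenvectorUnitary, hA.1.eigenvalues, ?_, ?_, hA.eigenvalues_nonneg, ?_, ?_⟩
  · exact Unitary.coe_star_mul_self _
  · exact Unitary.coe_mul_star_self _
  · exact hA.1.spectral_theorem
  · intro f
    rw [hA.1.cfc_eq]
    rfl

-- Expresses traces involving two eigenbases through entries taken between them: `X = Y = 1`
-- produces the overlaps, and `X = Y` Hermitian the squared moduli needed for `X²`.
open Matrix in
theorem trace_diagonalized_mul {d : Type*} [Fintype d] [DecidableEq d]
    (U V X : Matrix d d ℂ) {Y : Matrix d d ℂ} (hY : Y.IsHermitian) (l m : d → ℝ) :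
    (trace ((U * diagonal (fun a ↦ (l a : ℂ)) * Uᴴ) * X *
      (V * diagonal (fun b ↦ (m b : ℂ)) * Vᴴ) * Y)).re =
      ∑ a, ∑ b, l a * m b * ((Uᴴ * X * V) a b * star ((Uᴴ * Y * V) a b)).re := by
  have h1 : trace ((U * diagonal (fun a ↦ (l a : ℂ)) * Uᴴ) * X *
      (V * diagonal (fun b ↦ (m b : ℂ)) * Vᴴ) * Y) =
      trace ((diagonal (fun a ↦ (l a : ℂ)) * (Uᴴ * X * V)) *
        (diagonal (fun b ↦ (m b : ℂ)) * (Uᴴ * Y * V)ᴴ)) := by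
    simp only [conjTranspose_mul, conjTranspose_conjTranspose, hY.eq, Matrix.mul_assoc]
    rw [trace_mul_comm U]
    simp only [Matrix.mul_assoc]
  rw [h1]
  simp only [trace, diag_apply, Matrix.mul_apply (M := _ * _), diagonal_mul, conjTranspose_apply,
    Complex.re_sum]
  refine Finset.sum_congr rfl fun a _ ↦ Finset.sum_congr rfl fun b _ ↦ ?_
  rw [← Complex.re_ofReal_mul]
  push_cast
  ring_nf

open Matrix in
theorem re_trace_mul_nonneg {d : Type*} [Fintype d] [DecidableEq d]
    {A B : Matrix d d ℂ} (hA : A.PosSemidef) (hB : B.PosSemidef) : 0 ≤ (trace (A * B)).re := by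
  obtain ⟨U, l, -, hU, hl, hA', -⟩ := exists_diagonalization hA
  obtain ⟨V, m, -, hV, hm, hB', -⟩ := exists_diagonalization hB
  have := trace_diagonalized_mul U V 1 isHermitian_one l m
  rw [← hA', ← hB', mul_one, mul_one] at this
  rw [this]
  refine Finset.sum_nonneg fun a _ ↦ Finset.sum_nonneg fun b _ ↦
    mul_nonneg (mul_nonneg (hl a) (hm b)) ?_
  rw [← starRingEnd_apply, Complex.mul_conj]
  exact Complex.normSq_nonneg _

open Matrix in
/-- The Kadison inequality `(∑ x_j Λ_j)² ≤ ∑ x_j² Λ_j` for a POVM, tested on a positive matrix. -/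
theorem IsPOVM.re_trace_mul_sq_le {d κ : Type*} [Fintype d] [DecidableEq d] [Fintype κ]
    {Λ : κ → Matrix d d ℂ} (hΛ : IsPOVM Λ) {A : Matrix d d ℂ} (hA : A.PosSemidef) (x : κ → ℝ) :
    (trace (A * ((∑ j, (x j : ℂ) • Λ j) * ∑ j, (x j : ℂ) • Λ j))).re ≤
      ∑ j, x j ^ 2 * (trace (A * Λ j)).re := by
  set X := ∑ j, (x j : ℂ) • Λ j with hX
  have hXh : Xᴴ = X := by
    simp [hX, conjTranspose_sum, (hΛ.posSemidef _).1.eq]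
  -- An operator variance: these positive matrices sum to `∑ x j ^ 2 Λ j - X²`.
  have key : ∀ j, (((x j : ℂ) • 1 - X) * Λ j * ((x j : ℂ) • 1 - X)) =
      ((x j ^ 2 : ℝ) : ℂ) • Λ j - ((x j : ℂ) • Λ j) * X - X * ((x j : ℂ) • Λ j) + X * Λ j * X := by
    intro j
    simp only [sub_mul, mul_sub, smul_mul_assoc, mul_smul_comm, one_mul, mul_one, smul_sub,
      smul_smul, Complex.ofReal_mul, pow_two]
    abel
  have hsum : ∑ j, (((x j : ℂ) • 1 - X) * Λ j * ((x j : ℂ) • 1 - X)) =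
      ∑ j, ((x j ^ 2 : ℝ) : ℂ) • Λ j - X * X := by
    simp only [key, Finset.sum_add_distrib, Finset.sum_sub_distrib, ← Finset.sum_mul,
      ← Finset.mul_sum, hΛ.sum_eq_one, ← hX, mul_one]
    abel
  have hpsd : (∑ j, (((x j : ℂ) • 1 - X) * Λ j * ((x j : ℂ) • 1 - X))).PosSemidef := by
    refine posSemidef_sum _ fun j _ ↦ ?_
    have := (hΛ.posSemidef j).mul_mul_conjTranspose_same ((x j : ℂ) • 1 - X)
    simpa [conjTranspose_sub, hXh] using this
  have h0 := re_trace_mul_nonneg hA hpsd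
  rw [hsum, mul_sub, trace_sub, Complex.sub_re, sub_nonneg] at h0
  refine h0.trans_eq ?_
  simp only [Finset.mul_sum, trace_sum, mul_smul_comm, trace_smul, smul_eq_mul, Complex.re_sum,
    Complex.re_ofReal_mul]

/-- Completing the square in `z`; when `m + t * l > 0` the optimum is `z = l w / (m + t l)`. In use,
`w` is an overlap of eigenvectors and `z` the matching entry of `X`. -/
theorem two_mul_sub_sq_le_div {l m t : ℝ} (hl : 0 ≤ l) (hm : 0 ≤ m) (ht : 0 < t)
    (z w : ℂ) :
    2 * (l * (z * star w).re) - m * (z * star z).re - t * (l * (z * star z).re) ≤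
      (l * (w * star w).re) ^ 2 / (m * (w * star w).re + t * (l * (w * star w).re)) := by
  have hz : (z * star z).re = z.re ^ 2 + z.im ^ 2 := by simp [Complex.mul_re]; ring
  have hw : (w * star w).re = w.re ^ 2 + w.im ^ 2 := by simp [Complex.mul_re]; ring
  have hzw : (z * star w).re = z.re * w.re + z.im * w.im := by simp [Complex.mul_re]
  rw [hz, hw, hzw]
  rcases hl.eq_or_lt with rfl | hl
  · have : 0 ≤ m * (z.re ^ 2 + z.im ^ 2) := by positivity
    simpa using this
  · by_cases h0 : w.re ^ 2 + w.im ^ 2 = 0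
    · have h1 : w.re = 0 := by nlinarith [sq_nonneg w.re, sq_nonneg w.im]
      have h2 : w.im = 0 := by nlinarith [sq_nonneg w.re, sq_nonneg w.im]
      have : 0 ≤ m * (z.re ^ 2 + z.im ^ 2) + t * (l * (z.re ^ 2 + z.im ^ 2)) := by positivity
      simp only [h1, h2]
      simp
      linarith
    · have hw0 : 0 < w.re ^ 2 + w.im ^ 2 := lt_of_le_of_ne (by positivity) (Ne.symm h0)
      have hs : 0 < m + t * l := by positivity
      have e : (l * (w.re ^ 2 + w.im ^ 2)) ^ 2 /
          (m * (w.re ^ 2 + w.im ^ 2) + t * (l * (w.re ^ 2 + w.im ^ 2))) =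
          l ^ 2 * (w.re ^ 2 + w.im ^ 2) / (m + t * l) := by
        field_simp
      rw [e, le_div_iff₀ hs]
      nlinarith [sq_nonneg (l * w.re - (m + t * l) * z.re),
        sq_nonneg (l * w.im - (m + t * l) * z.im)]

/-! ### Monotonicity of relative entropy under measurement -/

open Matrix in
/-- Relative entropy does not increase under a measurement. -/
theorem IsPOVM.relEntropy_le {d κ : Type*} [Fintype d] [DecidableEq d] [Fintype κ]
    {Λ : κ → Matrix d d ℂ} (hΛ : IsPOVM Λ) {ρ σ : Matrix d d ℂ} (hρ : ρ.PosSemidef)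
    (hσ : σ.PosSemidef) {c : ℝ} (hc : 0 < c) (hle : (σ - (c : ℂ) • ρ).PosSemidef) :
    ∑ j, (trace (ρ * Λ j)).re *
        (Real.logb 2 (trace (ρ * Λ j)).re - Real.logb 2 (trace (σ * Λ j)).re) ≤
      (trace (ρ * cfc (Real.logb 2) ρ)).re - (trace (ρ * cfc (Real.logb 2) σ)).re := by
  obtain ⟨U, l, hU', hU, hl, hρ', hρf⟩ := exists_diagonalization hρ
  obtain ⟨V, m, hV', hV, hm, hσ', hσf⟩ := exists_diagonalization hσ
  set w : d → d → ℝ := fun a b ↦ ((Uᴴ * V) a b * star ((Uᴴ * V) a b)).re with hw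
  have hw0 : ∀ a b, 0 ≤ w a b := fun a b ↦ by
    simp only [hw]
    rw [← starRingEnd_apply, Complex.mul_conj]
    exact Complex.normSq_nonneg _
  have hone : ∀ {W : Matrix d d ℂ}, W * Wᴴ = 1 →
      W * diagonal (fun _ ↦ ((1 : ℝ) : ℂ)) * Wᴴ = 1 := by
    intro W hW
    simp [hW]
  -- The `b`-th diagonal entry of `σ - c ρ ≥ 0` in the eigenbasis of `σ` gives `c * ∑ a, l a * w a b
  -- ≤ m b`.
  have hsupp : ∀ a b, 0 < l a * w a b → 0 < m b * w a b := by
    intro a b hab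
    have h1 : 0 ≤ ((Vᴴ * (σ - (c : ℂ) • ρ) * V) b b).re :=
      (Complex.nonneg_iff.1 (hle.conjTranspose_mul_mul_same V).diag_nonneg).1
    have h2 : Vᴴ * σ * V = diagonal (fun b ↦ (m b : ℂ)) := by
      rw [hσ']
      calc _ = (Vᴴ * V) * diagonal (fun b ↦ (m b : ℂ)) * (Vᴴ * V) := by
            simp only [Matrix.mul_assoc]
        _ = _ := by rw [hV', Matrix.one_mul, Matrix.mul_one]
    have h3 : Vᴴ * ρ * V = (Uᴴ * V)ᴴ * (diagonal (fun a ↦ (l a : ℂ)) * (Uᴴ * V)) := by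
      conv_lhs => rw [hρ']
      simp only [conjTranspose_mul, conjTranspose_conjTranspose, Matrix.mul_assoc]
    have h4 : ((Vᴴ * ρ * V) b b).re = ∑ a, l a * w a b := by
      rw [h3, Matrix.mul_apply, Complex.re_sum]
      refine Finset.sum_congr rfl fun a _ ↦ ?_
      rw [diagonal_mul, conjTranspose_apply, mul_left_comm, Complex.re_ofReal_mul, mul_comm (star _)]
    have h5 : c * ∑ a, l a * w a b ≤ m b := by
      rw [mul_sub, sub_mul, h2, Matrix.sub_apply, Complex.sub_re, mul_smul_comm, smul_mul_assoc,
        Matrix.smul_apply, smul_eq_mul, Complex.re_ofReal_mul, h4] at h1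
      simpa using h1
    have h6 : l a * w a b ≤ ∑ a, l a * w a b :=
      Finset.single_le_sum (f := fun a ↦ l a * w a b)
        (fun a _ ↦ mul_nonneg (hl a) (hw0 a b)) (Finset.mem_univ a)
    exact mul_pos ((mul_pos hc (hab.trans_le h6)).trans_le h5)
      ((hw0 a b).lt_of_ne' (right_ne_zero_of_mul hab.ne'))
  have hrow : ∀ a, ∑ b, w a b = 1 := by
    intro a
    have h1 : (Uᴴ * V) * (Uᴴ * V)ᴴ = 1 := by
      rw [conjTranspose_mul, conjTranspose_conjTranspose, Matrix.mul_assoc, ← Matrix.mul_assoc V,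
        hV, Matrix.one_mul, hU']
    have h2 := congr_arg Complex.re (congr_fun (congr_fun h1 a) a)
    rw [Matrix.mul_apply, Complex.re_sum, Matrix.one_apply_eq] at h2
    exact h2
  have hself : (trace (ρ * cfc (Real.logb 2) ρ)).re =
      ∑ a, ∑ b, l a * w a b * Real.logb 2 (l a) := by
    have := trace_diagonalized_mul U U 1 isHermitian_one l (fun b ↦ Real.logb 2 (l b))
    rw [← hρ', ← hρf, mul_one, mul_one] at this
    rw [this]
    refine Finset.sum_congr rfl fun a _ ↦ ?_
    rw [← Finset.sum_mul, ← Finset.mul_sum, hrow, mul_one, mul_one, hU']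
    simp [Matrix.one_apply, apply_ite]
  have hcross : (trace (ρ * cfc (Real.logb 2) σ)).re =
      ∑ a, ∑ b, l a * w a b * Real.logb 2 (m b) := by
    have := trace_diagonalized_mul U V 1 isHermitian_one l (fun b ↦ Real.logb 2 (m b))
    rw [← hρ', ← hσf, mul_one, mul_one] at this
    rw [this]
    refine Finset.sum_congr rfl fun a _ ↦ Finset.sum_congr rfl fun b _ ↦ ?_
    simp only [hw, mul_one]
    ring
  have hsubtr : ∀ {A : Matrix d d ℂ}, A.PosSemidef → ∀ j, 0 ≤ (trace (A * Λ j)).re :=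
    fun hA j ↦ re_trace_mul_nonneg hA (hΛ.posSemidef j)
  have hdom : ∀ j, c * (trace (ρ * Λ j)).re ≤ (trace (σ * Λ j)).re := by
    intro j
    have := hsubtr hle j
    rwa [sub_mul, trace_sub, Complex.sub_re, smul_mul_assoc, trace_smul, smul_eq_mul,
      Complex.re_ofReal_mul, sub_nonneg] at this
  have main := sum_mul_log_sub_log_le (p := fun j ↦ (trace (ρ * Λ j)).re)
    (q := fun j ↦ (trace (σ * Λ j)).re) (P := fun ab : d × d ↦ l ab.1 * w ab.1 ab.2)
    (Q := fun ab ↦ m ab.2 * w ab.1 ab.2) (hsubtr hρ)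
    (fun ab ↦ mul_nonneg (hl _) (hw0 _ _))
    (fun j hj ↦ (mul_pos hc hj).trans_le (hdom j))
    (fun ab hab ↦ hsupp _ _ hab) ?_ ?_
  -- The common factor `w a b` cancels in the difference of logarithms.
  · have e : (trace (ρ * cfc (Real.logb 2) ρ)).re - (trace (ρ * cfc (Real.logb 2) σ)).re =
        (∑ ab : d × d, l ab.1 * w ab.1 ab.2 * (Real.log (l ab.1 * w ab.1 ab.2) -
          Real.log (m ab.2 * w ab.1 ab.2))) / Real.log 2 := by
      rw [hself, hcross, Fintype.sum_prod_type, Finset.sum_div, ← Finset.sum_sub_distrib]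
      refine Finset.sum_congr rfl fun a _ ↦ ?_
      rw [Finset.sum_div, ← Finset.sum_sub_distrib]
      refine Finset.sum_congr rfl fun b _ ↦ ?_
      rcases (mul_nonneg (hl a) (hw0 a b)).eq_or_lt with h0 | h0
      · simp [← h0]
      · have h1 : 0 < m b * w a b := hsupp a b h0
        rw [Real.log_mul (left_ne_zero_of_mul h0.ne') (right_ne_zero_of_mul h0.ne'),
          Real.log_mul (left_ne_zero_of_mul h1.ne') (right_ne_zero_of_mul h1.ne')]
        simp only [Real.logb]
        ring
    rw [e, le_div_iff₀ (Real.log_pos one_lt_two)]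
    refine le_of_eq_of_le ?_ main
    rw [Finset.sum_mul]
    refine Finset.sum_congr rfl fun j _ ↦ ?_
    have : Real.log 2 ≠ 0 := (Real.log_pos one_lt_two).ne'
    simp only [Real.logb]
    field_simp
  · rw [← Complex.re_sum, ← trace_sum, ← Finset.mul_sum, hΛ.sum_eq_one, mul_one,
      Fintype.sum_prod_type]
    simp only [← Finset.mul_sum, hrow, mul_one]
    rw [hρ', trace_mul_cycle, hU', Matrix.one_mul, trace_diagonal, Complex.re_sum]
    rfl
  · intro t ht
    -- The maximizer of `2 x p - x² (q + t p)` for the measured probabilities. Where the denominator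
    -- is zero, `x j = 0` and both sides of the first equality below have zero term.
    set x : κ → ℝ := fun j ↦ (trace (ρ * Λ j)).re /
      ((trace (σ * Λ j)).re + t * (trace (ρ * Λ j)).re) with hx
    set X := ∑ j, (x j : ℂ) • Λ j with hX
    have hXh : X.IsHermitian := by
      simp [IsHermitian, hX, conjTranspose_sum, (hΛ.posSemidef _).1.eq]
    have e1 : (trace (ρ * X)).re =
        ∑ a, ∑ b, l a * ((Uᴴ * X * V) a b * star ((Uᴴ * V) a b)).re := by
      have := trace_diagonalized_mul U V X isHermitian_one l (fun _ ↦ 1)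
      rw [← hρ', hone hV, mul_one, mul_one] at this
      simpa using this
    have e2 : (trace (ρ * (X * X))).re =
        ∑ a, ∑ b, l a * ((Uᴴ * X * V) a b * star ((Uᴴ * X * V) a b)).re := by
      have := trace_diagonalized_mul U V X hXh l (fun _ ↦ 1)
      rw [← hρ', hone hV, mul_one] at this
      simpa only [Matrix.mul_assoc, mul_one] using this
    have e3 : (trace (σ * (X * X))).re =
        ∑ a, ∑ b, m b * ((Uᴴ * X * V) a b * star ((Uᴴ * X * V) a b)).re := by
      have := trace_diagonalized_mul U V X hXh (fun _ ↦ 1) m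
      rw [← hσ', hone hU, one_mul, Matrix.mul_assoc, trace_mul_comm, Matrix.mul_assoc] at this
      simpa only [Matrix.mul_assoc, one_mul] using this
    have k1 := hΛ.re_trace_mul_sq_le hρ x
    have k2 := hΛ.re_trace_mul_sq_le hσ x
    have k3 : (trace (ρ * X)).re = ∑ j, x j * (trace (ρ * Λ j)).re := by
      simp only [hX, Finset.mul_sum, trace_sum, mul_smul_comm, trace_smul, smul_eq_mul,
        Complex.re_sum, Complex.re_ofReal_mul]
    calc ∑ j, (trace (ρ * Λ j)).re ^ 2 / ((trace (σ * Λ j)).re + t * (trace (ρ * Λ j)).re)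
        = 2 * (trace (ρ * X)).re - ∑ j, x j ^ 2 * (trace (σ * Λ j)).re -
            t * ∑ j, x j ^ 2 * (trace (ρ * Λ j)).re := by
          rw [k3, Finset.mul_sum, Finset.mul_sum, ← Finset.sum_sub_distrib,
            ← Finset.sum_sub_distrib]
          refine Finset.sum_congr rfl fun j _ ↦ ?_
          simp only [hx]
          by_cases h0 : (trace (σ * Λ j)).re + t * (trace (ρ * Λ j)).re = 0
          · simp [h0]
          · generalize (trace (ρ * Λ j)).re = r at h0 ⊢
            generalize (trace (σ * Λ j)).re = s at h0 ⊢
            have h1 : r / (s + t * r) * (s + t * r) = r := div_mul_cancel₀ _ h0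
            generalize hy : r / (s + t * r) = y at h1 ⊢
            rw [pow_two, mul_div_assoc, hy]
            linear_combination (y : ℝ) * h1
      _ ≤ 2 * (trace (ρ * X)).re - (trace (σ * (X * X))).re - t * (trace (ρ * (X * X))).re := by
          have := mul_le_mul_of_nonneg_left k1 ht.le
          linarith
      _ ≤ _ := by
          rw [e1, e2, e3, Fintype.sum_prod_type]
          simp only [Finset.mul_sum]
          rw [← Finset.sum_sub_distrib, ← Finset.sum_sub_distrib]
          refine Finset.sum_le_sum fun a _ ↦ ?_
          rw [← Finset.sum_sub_distrib, ← Finset.sum_sub_distrib]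
          exact Finset.sum_le_sum fun b _ ↦ two_mul_sub_sq_le_div (hl a) (hm b) ht _ _

/-! ### Holevo's bound -/

open Matrix in
/-- The Holevo information is the average relative entropy to the mean state. -/
theorem holevoInfo_eq {d ι : Type*} [Fintype d] [DecidableEq d] [Fintype ι]
    (p : ι → ℝ) (ρ : ι → Matrix d d ℂ) :
    holevoInfo p ρ = ∑ i, p i * ((trace (ρ i * cfc (Real.logb 2) (ρ i))).re -
      (trace (ρ i * cfc (Real.logb 2) (∑ i, (p i : ℂ) • ρ i))).re) := by
  simp only [holevoInfo, vonNeumannEntropy]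
  set L := cfc (Real.logb 2) (∑ i, (p i : ℂ) • ρ i)
  simp only [Finset.sum_mul, smul_mul_assoc, trace_sum, trace_smul, smul_eq_mul, Complex.re_sum,
    Complex.re_ofReal_mul, mul_sub, mul_neg, Finset.sum_sub_distrib, Finset.sum_neg_distrib]
  ring

section JointLaw

variable {d ι κ : Type*} [Fintype d] [DecidableEq d] [Fintype κ]
  {p : ι → ℝ} {ρ : ι → Matrix d d ℂ} {Λ : κ → Matrix d d ℂ}

theorem condProb_nonneg (hρ : ∀ i, IsDensity (ρ i)) (hΛ : IsPOVM Λ) (i : ι) (j : κ) :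
    0 ≤ condProb ρ Λ i j :=
  re_trace_mul_nonneg (hρ i).posSemidef (hΛ.posSemidef j)

theorem jointProb_nonneg [Fintype ι] (hp : IsProbVec p) (hρ : ∀ i, IsDensity (ρ i)) (hΛ : IsPOVM Λ)
    (i : ι) (j : κ) : 0 ≤ jointProb p ρ Λ i j :=
  mul_nonneg (hp.nonneg i) (condProb_nonneg hρ hΛ i j)

theorem sum_jointProb_right (hρ : ∀ i, IsDensity (ρ i)) (hΛ : IsPOVM Λ) (i : ι) :
    ∑ j, jointProb p ρ Λ i j = p i := by
  simp only [jointProb, condProb]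
  rw [← Finset.mul_sum, ← Complex.re_sum, ← Matrix.trace_sum, ← Finset.mul_sum, hΛ.sum_eq_one,
    mul_one, (hρ i).trace_eq_one, Complex.one_re, mul_one]

theorem outputProb_jointProb {d ι κ : Type*} [Fintype d] [Fintype ι] (p : ι → ℝ)
    (ρ : ι → Matrix d d ℂ) (Λ : κ → Matrix d d ℂ) (j : κ) :
    outputProb (jointProb p ρ Λ) j = (Matrix.trace ((∑ i, (p i : ℂ) • ρ i) * Λ j)).re := by
  simp only [outputProb, jointProb, condProb, Finset.sum_mul, smul_mul_assoc, Matrix.trace_sum,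
    Matrix.trace_smul, smul_eq_mul, Complex.re_sum, Complex.re_ofReal_mul]

/-- Holevo's bound. -/
theorem mutualInfo_le_holevoInfo [Fintype ι] (hp : IsProbVec p) (hρ : ∀ i, IsDensity (ρ i)) (hΛ : IsPOVM Λ) :
    mutualInfo (jointProb p ρ Λ) ≤ holevoInfo p ρ := by
  classical
  rw [holevoInfo_eq, mutualInfo]
  have hsmul : ∀ i, ((p i : ℂ) • ρ i).PosSemidef := fun i ↦
    (hρ i).posSemidef.smul (Complex.zero_le_real.2 (hp.nonneg i))
  refine Finset.sum_le_sum fun i _ ↦ ?_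
  rcases (hp.nonneg i).eq_or_lt with h0 | h0
  · simp [jointProb, ← h0]
  refine le_of_eq_of_le ?_ (mul_le_mul_of_nonneg_left (hΛ.relEntropy_le (hρ i).posSemidef
    (Matrix.posSemidef_sum Finset.univ fun i _ ↦ hsmul i) h0 ?_) h0.le)
  · rw [Finset.mul_sum]
    refine Finset.sum_congr rfl fun j _ ↦ ?_
    rw [← outputProb_jointProb, inputProb, sum_jointProb_right hρ hΛ, jointProb, mul_assoc,
      mul_div_mul_left _ _ h0.ne']
    change p i * (condProb ρ Λ i j * _) = p i * (condProb ρ Λ i j * _)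
    rcases (condProb_nonneg hρ hΛ i j).eq_or_lt with h1 | h1
    · simp [← h1]
    · have h2 : 0 < outputProb (jointProb p ρ Λ) j :=
        (mul_pos h0 h1).trans_le (Finset.single_le_sum (f := fun i ↦ jointProb p ρ Λ i j)
          (fun i _ ↦ jointProb_nonneg hp hρ hΛ i j) (Finset.mem_univ i))
      rw [Real.logb_div h1.ne' h2.ne']
      rfl
  -- The mean state minus `p i • ρ i` is the sum of the other weighted states, so `c = p i` gives
  -- the required domination.
  · rw [← Finset.add_sum_erase _ _ (Finset.mem_univ i), add_sub_cancel_left]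
    exact Matrix.posSemidef_sum _ fun i _ ↦ hsmul i

end JointLaw

/-! ### Kelly betting with side information -/

section Kelly

variable {ι κ : Type*} [Fintype ι]

theorem coe_sum_eq_sum_coe {α : Type*} (s : Finset α) (f : α → ℝ) :
    ((∑ a ∈ s, f a : ℝ) : EReal) = ∑ a ∈ s, (f a : EReal) :=
  map_sum (⟨⟨Real.toEReal, EReal.coe_zero⟩, EReal.coe_add⟩ : ℝ →+ EReal) f s

theorem sum_eq_bot_of_mem {α : Type*} {s : Finset α} {f : α → EReal} {a : α} (ha : a ∈ s)
    (h : f a = ⊥) : ∑ a ∈ s, f a = ⊥ := by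
  classical
  rw [← Finset.add_sum_erase _ _ ha, h, EReal.bot_add]

theorem coe_mul_elog2 {r x : ℝ} (h : r ≠ 0 → 0 < x) :
    (r : EReal) * elog2 x = ((r * Real.logb 2 x : ℝ) : EReal) := by
  by_cases hr : r = 0
  · simp [hr]
  · rw [elog2, if_neg (h hr).not_ge, EReal.coe_mul]

variable {P : ι → κ → ℝ} {p o : ι → ℝ}

theorem le_outputProb (hP : ∀ i j, 0 ≤ P i j) (i : ι) (j : κ) : P i j ≤ outputProb P j :=
  Finset.single_le_sum (f := fun i ↦ P i j) (fun i _ ↦ hP i j) (Finset.mem_univ i)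

theorem outputProb_nonneg (hP : ∀ i j, 0 ≤ P i j) (j : κ) : 0 ≤ outputProb P j :=
  Finset.sum_nonneg fun i _ ↦ hP i j

variable (P) in
open Classical in
/-- Proportional betting, with everything retained on outputs of probability zero. -/
def proportionalStrategy (hP : ∀ i j, 0 ≤ P i j) : Strategy ι κ where
  retained j := if 0 < outputProb P j then 0 else 1
  bet j i := if 0 < outputProb P j then posterior P i j else 0
  retained_nonneg j := by split_ifs <;> simp
  bet_nonneg j i := by
    split_ifs with h
    · exact div_nonneg (hP i j) h.le
    · exact le_rfl
  sum_eq_one j := by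
    split_ifs with h
    · simp only [posterior, ← Finset.sum_div]
      rw [zero_add]
      exact div_self h.ne'
    · simp

theorem isProportional_proportionalStrategy (hP : ∀ i j, 0 ≤ P i j) :
    IsProportional P (proportionalStrategy P hP) := fun _ hj ↦
  ⟨if_pos hj, fun _ ↦ if_pos hj⟩

variable [Fintype κ]

theorem pos_of_joint_pos {ι κ : Type*} [Fintype κ] {P : ι → κ → ℝ} {p : ι → ℝ}
    (hP : ∀ i j, 0 ≤ P i j) (hp : ∀ i, ∑ j, P i j = p i) {i : ι} {j : κ}
    (h : 0 < P i j) : 0 < p i :=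
  hp i ▸ h.trans_le (Finset.single_le_sum (f := P i) (fun j _ ↦ hP i j) (Finset.mem_univ j))

theorem doublingRate_of_isProportional (hP : ∀ i j, 0 ≤ P i j) (hp : ∀ i, ∑ j, P i j = p i)
    (ho : ∀ i, 0 < p i → o i = 1 / p i) {b : Strategy ι κ} (hb : IsProportional P b) :
    doublingRate P o b = (mutualInfo P : EReal) := by
  simp only [doublingRate, mutualInfo, coe_sum_eq_sum_coe]
  refine Finset.sum_congr rfl fun i _ ↦ Finset.sum_congr rfl fun j _ ↦ ?_
  rcases (hP i j).eq_or_lt with h0 | h0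
  · simp [← h0]
  have hq := h0.trans_le (le_outputProb hP i j)
  have hpi := pos_of_joint_pos hP hp h0
  have hg : growthFactor o b i j = P i j / (inputProb P i * outputProb P j) := by
    rw [growthFactor, (hb j hq).1, (hb j hq).2, ho i hpi, inputProb, hp, posterior]
    field_simp
    ring
  rw [coe_mul_elog2 fun _ ↦ ?_, hg]
  rw [hg, inputProb, hp]
  positivity

theorem doublingRate_le_mutualInfo (hP : ∀ i j, 0 ≤ P i j) (hp : ∀ i, ∑ j, P i j = p i)
    (hsum : ∑ i, p i = 1) (ho : ∀ i, 0 < p i → o i = 1 / p i) (b : Strategy ι κ) :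
    doublingRate P o b ≤ (mutualInfo P : EReal) := by
  by_cases hruin : ∃ i j, 0 < P i j ∧ growthFactor o b i j ≤ 0
  · obtain ⟨i, j, h0, hg⟩ := hruin
    refine le_of_eq_of_le (sum_eq_bot_of_mem (Finset.mem_univ i)
      (sum_eq_bot_of_mem (Finset.mem_univ j) ?_)) bot_le
    rw [elog2, if_pos hg, EReal.coe_mul_bot_of_pos h0]
  push Not at hruin
  -- This is `log y ≤ y - 1` with `y` the ratio of the growth factor to the proportional one,
  -- multiplied by `P i j`. If `P i j = 0`, the correction term is merely nonnegative.
  have hterm : ∀ i j, P i j * Real.logb 2 (growthFactor o b i j) ≤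
      P i j * Real.logb 2 (P i j / (inputProb P i * outputProb P j)) +
        (outputProb P j * (b.retained j * p i + b.bet j i) - P i j) / Real.log 2 := by
    intro i j
    have hpi0 : 0 ≤ p i := hp i ▸ Finset.sum_nonneg fun j _ ↦ hP i j
    have hlog2 : 0 < Real.log 2 := Real.log_pos one_lt_two
    rcases (hP i j).eq_or_lt with h0 | h0
    · rw [← h0]
      have := outputProb_nonneg hP j
      have := b.retained_nonneg j
      have := b.bet_nonneg j i
      simp only [zero_mul, sub_zero, zero_add]
      positivity
    have hq := h0.trans_le (le_outputProb hP i j)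
    have hpi := pos_of_joint_pos hP hp h0
    have hg := hruin i j h0
    have hge : growthFactor o b i j * p i = b.retained j * p i + b.bet j i := by
      rw [growthFactor, ho i hpi]
      field_simp
    rw [inputProb, hp, ← sub_le_iff_le_add', ← mul_sub,
      ← Real.logb_div hg.ne' (by positivity), Real.logb, mul_div_assoc']
    refine div_le_div_of_nonneg_right ?_ hlog2.le
    refine (mul_le_mul_of_nonneg_left (Real.log_le_sub_one_of_pos (by positivity)) h0.le).trans_eq ?_
    rw [← hge]
    field_simp
  -- For fixed `j` the inner bracket sums over `i` to `retained j + ∑ i, bet j i = 1`, leaving total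
  -- output mass minus total joint mass.
  have htotal : ∑ i, ∑ j, (outputProb P j * (b.retained j * p i + b.bet j i) - P i j) = 0 := by
    have h1 : ∑ i, ∑ j, P i j = 1 := by simp only [hp, hsum]
    have h2 : ∑ j, outputProb P j = 1 := by
      rw [← h1, Finset.sum_comm]
      rfl
    simp only [Finset.sum_sub_distrib]
    rw [h1, Finset.sum_comm]
    simp only [← Finset.mul_sum, Finset.sum_add_distrib, hsum, mul_one, b.sum_eq_one, h2, sub_self]
  have hreal : doublingRate P o b =
      ((∑ i, ∑ j, P i j * Real.logb 2 (growthFactor o b i j) : ℝ) : EReal) := by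
    simp only [doublingRate, coe_sum_eq_sum_coe]
    exact Finset.sum_congr rfl fun i _ ↦ Finset.sum_congr rfl fun j _ ↦
      coe_mul_elog2 fun h ↦ hruin i j ((hP i j).lt_of_ne' h)
  rw [hreal, EReal.coe_le_coe_iff]
  refine (Finset.sum_le_sum fun i _ ↦ Finset.sum_le_sum fun j _ ↦ hterm i j).trans_eq ?_
  simp only [Finset.sum_add_distrib, ← Finset.sum_div, htotal, zero_div, add_zero]
  rfl

theorem mutualInfo_eq_sum_posterior (hP : ∀ i j, 0 ≤ P i j) (hp : ∀ i, ∑ j, P i j = p i) :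
    mutualInfo P = ∑ j, outputProb P j *
      ∑ i, posterior P i j * Real.logb 2 (posterior P i j / p i) := by
  rw [mutualInfo, Finset.sum_comm]
  refine Finset.sum_congr rfl fun j _ ↦ ?_
  rw [Finset.mul_sum]
  refine Finset.sum_congr rfl fun i _ ↦ ?_
  rcases (hP i j).eq_or_lt with h0 | h0
  · simp [posterior, ← h0]
  have hq := h0.trans_le (le_outputProb hP i j)
  rw [inputProb, hp, posterior, ← mul_assoc, mul_div_cancel₀ _ hq.ne', div_div, mul_comm (p i)]

end Kelly

end QuantumKelly

end

theorem mainTheorem7 {d ι κ : Type*} [Fintype d] [DecidableEq d] [Fintype ι] [Fintype κ]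
    (p : ι → ℝ) (hp : IsProbVec p)
    (ρ : ι → Matrix d d ℂ) (hρ : ∀ i, IsDensity (ρ i))
    (Λ : κ → Matrix d d ℂ) (hΛ : IsPOVM Λ)
    (o : ι → ℝ) (ho : ∀ i, 0 < p i → o i = 1 / p i) :
    IsGreatest (Set.range (doublingRate (jointProb p ρ Λ) o))
        ((mutualInfo (jointProb p ρ Λ) : ℝ) : EReal) ∧
      (∃ b : Strategy ι κ, IsProportional (jointProb p ρ Λ) b) ∧
      (∀ b : Strategy ι κ, IsProportional (jointProb p ρ Λ) b →
        doublingRate (jointProb p ρ Λ) o b = ((mutualInfo (jointProb p ρ Λ) : ℝ) : EReal)) ∧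
      mutualInfo (jointProb p ρ Λ) =
        ∑ j, outputProb (jointProb p ρ Λ) j *
          ∑ i, posterior (jointProb p ρ Λ) i j *
            Real.logb 2 (posterior (jointProb p ρ Λ) i j / p i) ∧
      mutualInfo (jointProb p ρ Λ) ≤ holevoInfo p ρ := by
  have hP := jointProb_nonneg hp hρ hΛ
  have hpm := sum_jointProb_right (p := p) hρ hΛ
  have hprop := isProportional_proportionalStrategy hP
  refine ⟨⟨⟨_, doublingRate_of_isProportional hP hpm ho hprop⟩, ?_⟩, ⟨_, hprop⟩,
    fun b hb ↦ doublingRate_of_isProportional hP hpm ho hb,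
    mutualInfo_eq_sum_posterior hP hpm, mutualInfo_le_holevoInfo hp hρ hΛ⟩
  rintro _ ⟨b, rfl⟩
  exact doublingRate_le_mutualInfo hP hpm hp.sum_eq_one ho b
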